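/- **Setting.** Let $f:\mathbb R^n\to\mathbb R$, let $X\subseteq\mathbb R^n$ be closed and convex, $A'\in\mathbb R^{m\times n}$, $b'\in\mathbb R^m$, $A\in\mathbb R^{p\times n}$, $b\in\mathbb R^p$, and consider $$\text{minimize } f(x)\quad\text{subject to}\quad A'x+b'\le 0,\quad Ax+b=0,\quad x\in X .$$ Put $g^{(i)}(x)=(A'x+b')^{(i)}$, $\tilde A=\begin{bmatrix}A'\\A\end{bmatrix}$, $\sigma_{\max}(\tilde A)=\sqrt{\lambda_{\max}(\tilde A^T\tilde A)}$; $\|\cdot\|$ is the Euclidean norm. Assume: $f$ is lower semicontinuous on $X$ and strongly convex over $X$ with parameter $\theta>0$; there is a point $\tilde x\in\operatorname{relint}X$ with $g^{(i)}(\tilde x)<0$ for all $i$ and $A\tilde x+b=0$ (a *Slater point*); $m+p\ne0$; $A\neq0$ if $p\ne0$; and $\tilde A\ne0$. Let $f^\star$ be the optimal value. For $u\in\mathbb R^{m+p}$ let $$\mathcal L(x,u)=f(x)+\sum_{i=1}^m u^{(i)}g^{(i)}(x)+\bigl(u^{(m+1:m+p)}\bigr)^T(Ax+b),\qquad d(u)=\inf_{x\in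 X}\mathcal L(x,u),$$ $D=\{u\in\mathbb R^{m+p}:u^{(i)}\ge0,\ i=1,\dots,m\}$, $d^\star=\sup_D d$, $D^\star=\{u\in D: d(u)=\max_D d\}$, and $$\Delta(x)=\Bigl(\|Ax+b\|^2+\sum_{i=1}^m\max\{0,g^{(i)}(x)\}^2\Bigr)^{1/2}.$$ Then for every $u\in\mathbb R^{m+p}$ the function $\mathcal L(\cdot,u)$ has a unique minimizer $\bar x(u)$ over $X$, and $d$ is differentiable on $\mathbb R^{m+p}$. Let $\ell_{-d}(u,v)=-d(v)-\nabla d(v)^T(u-v)$. **Algorithm (Tseng's Algorithm 2 on the dual).** Let $\beta_0=\beta_{-1}=1$ and $u_0=u_{-1}\in D$. For each $k\ge0$: choose a closed convex set $U_k\subseteq\mathbb R^{m+p}$ with $U_k\cap D^\star\ne\emptyset$; let $$v_k=u_k+\beta_k\bigl(\beta_{k-1}^{-1}-1\bigr)(u_k-u_{k-1}),\qquad u_{k+1}=\operatorname*{arg\,min}_{u\in U_k\cap D}\ \ell_{-d}(u,v_k)+\frac{\sigma_{\max}^2(\tilde A)}{2\theta}\|u-v_k\|^2;$$ choose $\beta_{k+1}>0$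 with $\beta_{k+1}\le\frac{2}{k+3}$ and $\frac{1-\beta_{k+1}}{\beta_{k+1}^2}\le\frac1{\beta_k^2}$. **Proposition.** Let $(u_k)_{k\ge0}$ be generated by this algorithm and let $u^\star\in D^\star$ be such that $(1-\beta_k)u_k+\beta_ku^\star\in U_k$ for all $k\ge0$ (which is automatic if $U_k\supseteq D$, or if $u_k,u^\star\in U_k$, for all $k$). Then the problem has a unique optimal solution $x^\star$, and for every $k\ge1$ $$d^\star-d(u_k)\le\frac{2\sigma_{\max}^2(\tilde A)\|u_0-u^\star\|^2}{\theta(k+1)^2},\qquad \|\bar x(u_k)-x^\star\|\le\frac{2\sigma_{\max}(\tilde A)\|u_0-u^\star\|}{\theta(k+1)},$$ $$-\frac{2\|u^\star\|\sigma_{\max}^2(\tilde A)\|u_0-u^\star\|}{\theta(k+1)}\le f(\bar x(u_k))-f^\star\le\frac{2\|u_k\|\sigma_{\max}^2(\tilde A)\|u_0-u^\star\|}{\theta(k+1)},$$ $$\Delta(\bar x(u_k))\le\frac{2\sigma_{\max}^2(\tilde A)\|u_0-u^\star\|}{\theta(k+1)} .$$ Moreover, if $p=0$, then for every Slater point $\tilde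 x$, every $\bar u\in D\setminus D^\star$ and every integer $k>\sigma_{\max}(\tilde A)\|u_0-u^\star\|\left(\frac{2\theta^{-1}}{d^\star-d(\bar u)}\right)^{1/2}$, $$f(\bar x(u_k))-f^\star\le\frac{2\sigma_{\max}^2(\tilde A)\,(d(\bar u)-f(\tilde x))\,\|u_0-u^\star\|}{\theta(k+1)\max_{i\in\{1,\dots,m\}}g^{(i)}(\tilde x)} .$$ -/

import Mathlib

open scoped Matrix

noncomputable section

/-- `σ_max(M) = √(λ_max(Mᵀ M))`; it is `0` when `M` has no columns or no rows. -/
def sigmaMax {ι : Type*} [Fintype ι] {n : ℕ} (M : Matrix ι (Fin n) ℝ) : ℝ :=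
  Real.sqrt (⨆ i, (Matrix.isHermitian_conjTranspose_mul_self M).eigenvalues i)

/-- Data of the problem: minimize `f x` subject to `A' x + b' ≤ 0`, `A x + b = 0`, `x ∈ X`,
with `m` inequality and `p` equality constraints in `ℝⁿ`. -/
structure LinProblem (n m p : ℕ) where
  f : EuclideanSpace ℝ (Fin n) → ℝ
  X : Set (EuclideanSpace ℝ (Fin n))
  A' : Matrix (Fin m) (Fin n) ℝ
  b' : Fin m → ℝ
  A : Matrix (Fin p) (Fin n) ℝ
  b : Fin p → ℝ

namespace LinProblem

variable {n m p : ℕ} (P : LinProblem n m p)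

/-- The stacked matrix `Ã = [A'; A]`. -/
def At : Matrix (Fin m ⊕ Fin p) (Fin n) ℝ := Matrix.fromRows P.A' P.A

/-- The `i`-th inequality constraint function `x ↦ (A' x + b')ᵢ`. -/
def g (i : Fin m) (x : EuclideanSpace ℝ (Fin n)) : ℝ := (P.A' *ᵥ x.ofLp) i + P.b' i

/-- The `j`-th component of `A x + b`. -/
def eqRes (j : Fin p) (x : EuclideanSpace ℝ (Fin n)) : ℝ := (P.A *ᵥ x.ofLp) j + P.b j

/-- `x` satisfies the strict (Slater) feasibility condition. -/
def IsSlater (x : EuclideanSpace ℝ (Fin n)) : Prop :=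
  x ∈ intrinsicInterior ℝ P.X ∧ (∀ i, P.g i x < 0) ∧ ∀ j, P.eqRes j x = 0

/-- Standing assumptions on the problem, with convexity parameter `θ`. -/
structure Assumptions (θ : ℝ) : Prop where
  closed_X : IsClosed P.X
  convex_X : Convex ℝ P.X
  theta_pos : 0 < θ
  strongConvex : StrongConvexOn P.X θ P.f
  lsc : LowerSemicontinuousOn P.f P.X
  slater : ∃ x, P.IsSlater x
  constraints : m + p ≠ 0
  A_ne_zero : p ≠ 0 → P.A ≠ 0
  At_ne_zero : P.At ≠ 0

/-- The feasible set of the primal problem. -/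
def feasible : Set (EuclideanSpace ℝ (Fin n)) :=
  {x | x ∈ P.X ∧ (∀ i, P.g i x ≤ 0) ∧ ∀ j, P.eqRes j x = 0}

/-- `x` is an optimal solution of the primal problem. -/
def IsPrimalOptimal (x : EuclideanSpace ℝ (Fin n)) : Prop :=
  x ∈ P.feasible ∧ IsMinOn P.f P.feasible x

/-- The primal optimal value `f⋆`. -/
def fStar : ℝ := sInf (P.f '' P.feasible)

/-- The Lagrangian; the multipliers of the inequality constraints are `u (Sum.inl i)`, those of
the equality constraints are `u (Sum.inr j)`. -/
def lagrangian (x : EuclideanSpace ℝ (Fin n)) (u : EuclideanSpace ℝ (Fin m ⊕ Fin p)) : ℝ :=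
  P.f x + ∑ i, u (Sum.inl i) * P.g i x + ∑ j, u (Sum.inr j) * P.eqRes j x

/-- `x ∈ argmin_{x ∈ X} 𝓛(x, u)`. -/
def IsLagrangianMin (u : EuclideanSpace ℝ (Fin m ⊕ Fin p)) (x : EuclideanSpace ℝ (Fin n)) :
    Prop :=
  x ∈ P.X ∧ IsMinOn (fun y => P.lagrangian y u) P.X x

open Classical in
/-- `x̄(u)`, the minimizer over `X` of `𝓛(·, u)`. -/
def xbar (u : EuclideanSpace ℝ (Fin m ⊕ Fin p)) : EuclideanSpace ℝ (Fin n) :=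
  if h : ∃ x, P.IsLagrangianMin u x then h.choose else 0

/-- The dual function `d`. -/
def dual (u : EuclideanSpace ℝ (Fin m ⊕ Fin p)) : ℝ :=
  sInf ((fun x => P.lagrangian x u) '' P.X)

/-- The dual feasible set `D`. -/
def D (_P : LinProblem n m p) : Set (EuclideanSpace ℝ (Fin m ⊕ Fin p)) :=
  {u | ∀ i : Fin m, 0 ≤ u (Sum.inl i)}

/-- The dual optimal set `D⋆`. -/
def DStar : Set (EuclideanSpace ℝ (Fin m ⊕ Fin p)) :=
  {u | u ∈ P.D ∧ IsMaxOn P.dual P.D u}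

/-- The dual optimal value `d⋆`. -/
def dStar : ℝ := sSup (P.dual '' P.D)

/-- The primal infeasibility `Δ(x)`. -/
def infeas (x : EuclideanSpace ℝ (Fin n)) : ℝ :=
  Real.sqrt (∑ j, P.eqRes j x ^ 2 + ∑ i, max 0 (P.g i x) ^ 2)

/-- The linearization `ℓ_{-d}(u, v) = -d(v) - ∇d(v)ᵀ (u - v)`. -/
def ell (u v : EuclideanSpace ℝ (Fin m ⊕ Fin p)) : ℝ :=
  -P.dual v - inner ℝ (gradient P.dual v) (u - v)

/-- `(β, U, v, u)` is a run of Tseng's Algorithm 2 applied to the dual problem, with Lipschitz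
constant `σ_max(Ã)² / θ`. The conventions `β₋₁ = β₀ = 1`, `u₋₁ = u₀` amount to `v₀ = u₀`. -/
structure IsTsengRun (θ : ℝ) (β : ℕ → ℝ) (U : ℕ → Set (EuclideanSpace ℝ (Fin m ⊕ Fin p)))
    (v u : ℕ → EuclideanSpace ℝ (Fin m ⊕ Fin p)) : Prop where
  u_zero : u 0 ∈ P.D
  beta_zero : β 0 = 1
  beta_pos : ∀ k, 0 < β k
  beta_le : ∀ k : ℕ, β (k + 1) ≤ 2 / ((k : ℝ) + 3)
  beta_step : ∀ k, (1 - β (k + 1)) / β (k + 1) ^ 2 ≤ 1 / β k ^ 2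
  U_closed : ∀ k, IsClosed (U k)
  U_convex : ∀ k, Convex ℝ (U k)
  U_meets : ∀ k, (U k ∩ P.DStar).Nonempty
  v_zero : v 0 = u 0
  v_succ : ∀ k, v (k + 1) = u (k + 1) + (β (k + 1) * (1 / β k - 1)) • (u (k + 1) - u k)
  u_succ_mem : ∀ k, u (k + 1) ∈ U k ∩ P.D
  u_succ_min : ∀ k,
    IsMinOn (fun w => P.ell w (v k) + sigmaMax P.At ^ 2 / (2 * θ) * ‖w - v k‖ ^ 2)
      (U k ∩ P.D) (u (k + 1))

end LinProblem

end

/-! Strong convexity makes `d` smooth. Since `𝓛(·, u)` grows at least like `θ/2 ‖· - x̄(u)‖²` around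
its minimizer and the residual `Ãx + b̃` is `σ_max(Ã)`-Lipschitz, `d` lies below its linearization
with slope `P.resid (P.xbar u)`, and above it up to `σ_max² / (2θ) ‖w - u‖²`
(`dual_le_linearization`, `linearization_le_dual`). So that residual is `∇d(u)`, and the method uses
the right Lipschitz constant.

First-order optimality at `u⋆` gives feasibility of `x̄(u⋆)` and complementary slackness, hence
strong duality and `x⋆ = x̄(u⋆)`. Quadratic growth then yields `θ/2 ‖x̄(w) - x⋆‖² ≤ d⋆ - d(w)` on
`D` (`norm_xbar_sub_sq_le`), turning the accelerated `O(1/k²)` dual rate (`tseng_lyapunov`) into an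
`O(1/k)` primal distance. Infeasibility and objective error are controlled linearly by that
distance. For `p = 0` a Slater point bounds `‖u_k‖` once `d(u_k) ≥ d(ū)`. -/

/-- `‖M x‖² ≤ σ_max(M)² ‖x‖²`. -/
theorem sum_mulVec_sq_le_sigmaMax {ι : Type*} [Fintype ι] {n : ℕ} (M : Matrix ι (Fin n) ℝ)
    (x : EuclideanSpace ℝ (Fin n)) :
    ∑ i, (M *ᵥ x.ofLp) i ^ 2 ≤ sigmaMax M ^ 2 * ‖x‖ ^ 2 := by
  have hH := Matrix.isHermitian_conjTranspose_mul_self M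
  -- Expand `⟨x, MᵀM x⟩` in an orthonormal eigenbasis of `MᵀM`.
  have key : ∑ i, (M *ᵥ x.ofLp) i ^ 2 =
      ∑ i, hH.eigenvalues i * inner ℝ (hH.eigenvectorBasis i) x ^ 2 := by
    have h1 : ∑ i, (M *ᵥ x.ofLp) i ^ 2 = inner ℝ x (WithLp.toLp 2 ((Mᴴ * M) *ᵥ x.ofLp)) := by
      rw [EuclideanSpace.inner_eq_star_dotProduct, ← Matrix.mulVec_mulVec]
      simp only [star_trivial, Matrix.conjTranspose_eq_transpose_of_trivial,
        Matrix.mulVec_transpose, ← Matrix.dotProduct_mulVec]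
      simp [dotProduct, sq]
    rw [h1, ← hH.eigenvectorBasis.sum_inner_mul_inner]
    refine Finset.sum_congr rfl fun i _ => ?_
    have h2 : inner ℝ (hH.eigenvectorBasis i) (WithLp.toLp 2 ((Mᴴ * M) *ᵥ x.ofLp)) =
        hH.eigenvalues i * inner ℝ (hH.eigenvectorBasis i) x := by
      have h3 := hH.mulVec_eigenvectorBasis i
      rw [EuclideanSpace.inner_eq_star_dotProduct, EuclideanSpace.inner_eq_star_dotProduct]
      simp only [star_trivial]
      rw [dotProduct_comm, Matrix.dotProduct_mulVec, ← Matrix.mulVec_transpose,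
        ← Matrix.conjTranspose_eq_transpose_of_trivial, hH.eq, h3, smul_dotProduct,
        dotProduct_comm]
      simp
    rw [h2, real_inner_comm]
    ring
  have hbdd : BddAbove (Set.range hH.eigenvalues) := (Set.finite_range _).bddAbove
  have hnn : 0 ≤ ⨆ i, hH.eigenvalues i :=
    Real.iSup_nonneg (Matrix.posSemidef_conjTranspose_mul_self M).eigenvalues_nonneg
  rw [key, sigmaMax, Real.sq_sqrt hnn, ← hH.eigenvectorBasis.sum_sq_inner_right x, Finset.mul_sum]
  exact Finset.sum_le_sum fun i _ =>
    mul_le_mul_of_nonneg_right (le_ciSup hbdd i) (sq_nonneg _)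

theorem sigmaMax_nonneg {ι : Type*} [Fintype ι] {n : ℕ} (M : Matrix ι (Fin n) ℝ) :
    0 ≤ sigmaMax M := Real.sqrt_nonneg _

/-! ### Minimizers of strongly convex functions and proximal steps -/

section StrongConvexity

variable {E : Type*} [NormedAddCommGroup E] [NormedSpace ℝ E] {s : Set E} {c : ℝ} {h : E → ℝ}

/-- A strongly convex function grows quadratically away from its minimizer. -/
theorem StrongConvexOn.quadratic_growth (hh : StrongConvexOn s c h) {x : E} (hx : x ∈ s)
    (hmin : IsMinOn h s x) {y : E} (hy : y ∈ s) : h x + c / 2 * ‖y - x‖ ^ 2 ≤ h y := by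
  -- Compare `x` with `t • y + (1 - t) • x`; dividing by `t` leaves a factor `1 - t`, which tends to
  -- `1`.
  have key : ∀ t ∈ Set.Ioo (0 : ℝ) 1, h x + (1 - t) * (c / 2 * ‖y - x‖ ^ 2) ≤ h y := by
    rintro t ⟨ht0, ht1⟩
    have h1 := hh.2 hy hx ht0.le (sub_nonneg.2 ht1.le) (by ring)
    have h2 := isMinOn_iff.1 hmin _ (hh.1 hy hx ht0.le (sub_nonneg.2 ht1.le) (by ring))
    simp only [smul_eq_mul] at h1
    refine le_of_mul_le_mul_left (?_ : t * _ ≤ t * _) ht0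
    linarith
  have hlim : Filter.Tendsto (fun t : ℝ => h x + (1 - t) * (c / 2 * ‖y - x‖ ^ 2))
      (nhdsWithin 0 (Set.Ioi 0)) (nhds (h x + (1 - 0) * (c / 2 * ‖y - x‖ ^ 2))) :=
    (Continuous.tendsto (by fun_prop) 0).mono_left nhdsWithin_le_nhds
  rw [sub_zero, one_mul] at hlim
  exact le_of_tendsto hlim (Filter.mem_of_superset (Ioo_mem_nhdsGT one_pos) key)

/-- A lower semicontinuous strongly convex function attains its minimum on a nonempty closed
set of a finite-dimensional space. -/
theorem StrongConvexOn.exists_isMinOn [ProperSpace E] (hh : StrongConvexOn s c h) (hc : 0 < c)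
    (hs : IsClosed s) (hne : s.Nonempty) (hlsc : LowerSemicontinuousOn h s) :
    ∃ x ∈ s, IsMinOn h s x := by
  obtain ⟨x₀, hx₀⟩ := hne
  have hmin : ∀ r : ℝ, 0 ≤ r → ∃ a ∈ s ∩ Metric.closedBall x₀ r,
      IsMinOn h (s ∩ Metric.closedBall x₀ r) a := fun r hr =>
    (hlsc.mono Set.inter_subset_left).exists_isMinOn ⟨x₀, hx₀, Metric.mem_closedBall_self hr⟩
      ((isCompact_closedBall x₀ r).inter_left hs)
  obtain ⟨a, -, ha⟩ := hmin 1 zero_le_one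
  set q := h x₀ - h a with hq
  have hq0 : 0 ≤ q := sub_nonneg.2 (ha ⟨hx₀, Metric.mem_closedBall_self zero_le_one⟩)
  -- Coercivity radius: the point of the segment from `x₀` to `y` at distance `1` from `x₀` has
  -- value at least `h a`. Strong convexity then gives `h y ≥ h x₀ - r q + c/2 r (r - 1)`, which is
  -- at least `h x₀` once `r ≥ 1 + 2q/c`.
  set R := 1 + 2 * q / c with hR
  have hR1 : 1 ≤ R := le_add_of_nonneg_right (by positivity)
  have hfar : ∀ y ∈ s, R < ‖y - x₀‖ → h x₀ ≤ h y := by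
    intro y hy hr
    set r := ‖y - x₀‖ with hrdef
    have hr1 : 1 < r := hR1.trans_lt hr
    have hr0 : 0 < r := one_pos.trans hr1
    have hinv : r⁻¹ ≤ 1 := inv_le_one_of_one_le₀ hr1.le
    have hz := hh.1 hy hx₀ (inv_nonneg.2 hr0.le) (sub_nonneg.2 hinv) (by ring)
    have h1 := hh.2 hy hx₀ (inv_nonneg.2 hr0.le) (sub_nonneg.2 hinv) (by ring)
    have hball : r⁻¹ • y + (1 - r⁻¹) • x₀ ∈ Metric.closedBall x₀ 1 := by
      have : r⁻¹ • y + (1 - r⁻¹) • x₀ - x₀ = r⁻¹ • (y - x₀) := by module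
      rw [mem_closedBall_iff_norm, this, norm_smul, norm_inv, Real.norm_of_nonneg hr0.le,
        inv_mul_cancel₀ hr0.ne']
    have h2 : h a ≤ _ := ha ⟨hz, hball⟩
    simp only [smul_eq_mul, ← hrdef] at h1
    have h3 : r * h a ≤ h y + (r - 1) * h x₀ - (r - 1) * (c / 2 * r) := by
      have := mul_le_mul_of_nonneg_left (h2.trans h1) hr0.le
      have e : r * (r⁻¹ * h y + (1 - r⁻¹) * h x₀ - r⁻¹ * (1 - r⁻¹) * (c / 2 * r ^ 2)) =
        h y + (r - 1) * h x₀ - (r - 1) * (c / 2 * r) := by field_simp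
      linarith
    have h4 : q ≤ c / 2 * (r - 1) := by
      have : 2 * q / c < r - 1 := by linarith
      rw [div_lt_iff₀ hc] at this
      linarith
    have h5 : r * q ≤ r * (c / 2 * (r - 1)) := mul_le_mul_of_nonneg_left h4 hr0.le
    have h6 : r * q = r * h x₀ - r * h a := by rw [hq]; ring
    linarith
  obtain ⟨b, ⟨hbs, -⟩, hb⟩ := hmin R (zero_le_one.trans hR1)
  refine ⟨b, hbs, isMinOn_iff.2 fun y hy => ?_⟩
  by_cases hyR : ‖y - x₀‖ ≤ R
  · exact hb ⟨hy, mem_closedBall_iff_norm.2 hyR⟩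
  · have h1 : h b ≤ h x₀ := hb ⟨hx₀, Metric.mem_closedBall_self (zero_le_one.trans hR1)⟩
    have h2 := hfar y hy (not_le.1 hyR)
    linarith

end StrongConvexity

/-- Proximal step: if `w` minimizes an affine function plus `c/2 ‖· - v‖²` over a convex set,
then the objective grows quadratically away from `w`. -/
theorem prox_three_point {E : Type*} [NormedAddCommGroup E] [InnerProductSpace ℝ E] {s : Set E}
    (hs : Convex ℝ s) (a c : ℝ) (G v : E) {w : E} (hw : w ∈ s)
    (hmin : IsMinOn (fun z => a - inner ℝ G (z - v) + c / 2 * ‖z - v‖ ^ 2) s w)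
    {y : E} (hy : y ∈ s) :
    a - inner ℝ G (w - v) + c / 2 * ‖w - v‖ ^ 2 + c / 2 * ‖y - w‖ ^ 2 ≤
      a - inner ℝ G (y - v) + c / 2 * ‖y - v‖ ^ 2 := by
  refine StrongConvexOn.quadratic_growth (c := c) ?_ hw hmin hy
  rw [strongConvexOn_iff_convex]
  -- The quadratic part in `z` cancels exactly, leaving an affine function.
  have : (fun z : E => a - inner ℝ G (z - v) + c / 2 * ‖z - v‖ ^ 2 - c / 2 * ‖z‖ ^ 2) =
      fun z => inner ℝ (-(G + c • v)) z + (a + inner ℝ G v + c / 2 * ‖v‖ ^ 2) := by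
    funext z
    rw [norm_sub_sq_real, inner_sub_right, inner_neg_left, inner_add_left, real_inner_smul_left,
      real_inner_comm v z]
    ring
  rw [this]
  exact ((innerₗ E (-(G + c • v))).convexOn hs).add_const _

/-! ### The residual map and the Lagrangian -/

namespace LinProblem

variable {n m p : ℕ} (P : LinProblem n m p)

/-- The residual vector `Ã x + b̃`. -/
noncomputable def resid (x : EuclideanSpace ℝ (Fin n)) : EuclideanSpace ℝ (Fin m ⊕ Fin p) :=
  WithLp.toLp 2 (Sum.elim (fun i => P.g i x) fun j => P.eqRes j x)

@[simp] theorem resid_inl (x : EuclideanSpace ℝ (Fin n)) (i : Fin m) :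
    P.resid x (Sum.inl i) = P.g i x := rfl

@[simp] theorem resid_inr (x : EuclideanSpace ℝ (Fin n)) (j : Fin p) :
    P.resid x (Sum.inr j) = P.eqRes j x := rfl

theorem inner_resid (x : EuclideanSpace ℝ (Fin n)) (u : EuclideanSpace ℝ (Fin m ⊕ Fin p)) :
    inner ℝ (P.resid x) u =
      ∑ i, u (Sum.inl i) * P.g i x + ∑ j, u (Sum.inr j) * P.eqRes j x := by
  simp [PiLp.inner_apply, Fintype.sum_sum_type]

theorem lagrangian_eq (x : EuclideanSpace ℝ (Fin n)) (u : EuclideanSpace ℝ (Fin m ⊕ Fin p)) :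
    P.lagrangian x u = P.f x + inner ℝ (P.resid x) u := by
  rw [inner_resid, lagrangian, add_assoc]

theorem lagrangian_eq_add (x : EuclideanSpace ℝ (Fin n))
    (u w : EuclideanSpace ℝ (Fin m ⊕ Fin p)) :
    P.lagrangian x w = P.lagrangian x u + inner ℝ (P.resid x) (w - u) := by
  rw [lagrangian_eq, lagrangian_eq, inner_sub_right]
  ring

theorem norm_resid_sub_le (x y : EuclideanSpace ℝ (Fin n)) :
    ‖P.resid x - P.resid y‖ ≤ sigmaMax P.At * ‖x - y‖ := by
  refine le_of_sq_le_sq ?_ (mul_nonneg (sigmaMax_nonneg _) (norm_nonneg _))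
  rw [mul_pow, EuclideanSpace.real_norm_sq_eq]
  refine le_of_eq_of_le (Finset.sum_congr rfl fun i _ => ?_)
    (sum_mulVec_sq_le_sigmaMax P.At (x - y))
  congr 1
  rcases i with i | j
  · simp [At, Matrix.fromRows_mulVec, g, Matrix.mulVec_sub]
  · simp [At, Matrix.fromRows_mulVec, eqRes, Matrix.mulVec_sub]

theorem abs_inner_resid_sub_le (x y : EuclideanSpace ℝ (Fin n))
    (u : EuclideanSpace ℝ (Fin m ⊕ Fin p)) :
    |inner ℝ (P.resid x - P.resid y) u| ≤ sigmaMax P.At * ‖x - y‖ * ‖u‖ :=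
  (abs_real_inner_le_norm _ _).trans
    (mul_le_mul_of_nonneg_right (P.norm_resid_sub_le x y) (norm_nonneg _))

theorem continuous_resid : Continuous P.resid :=
  (LipschitzWith.of_dist_le_mul (K := ⟨sigmaMax P.At, sigmaMax_nonneg _⟩) fun x y => by
    rw [dist_eq_norm, dist_eq_norm]
    exact P.norm_resid_sub_le x y).continuous

theorem resid_convexCombo (x y : EuclideanSpace ℝ (Fin n)) {a b : ℝ} (hab : a + b = 1) :
    P.resid (a • x + b • y) = a • P.resid x + b • P.resid y := by
  obtain rfl := eq_sub_of_add_eq hab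
  ext (i | j)
  · simp [g, Matrix.mulVec_add, Matrix.mulVec_smul]
    ring
  · simp [eqRes, Matrix.mulVec_add, Matrix.mulVec_smul]
    ring

/-! ### Smoothness of the dual function -/

section Dual

variable {P} {θ : ℝ} (hP : P.Assumptions θ)

include hP

theorem Assumptions.nonempty_X : P.X.Nonempty :=
  let ⟨x, hx, _⟩ := hP.slater
  ⟨x, intrinsicInterior_subset hx⟩

theorem Assumptions.strongConvexOn_lagrangian (u : EuclideanSpace ℝ (Fin m ⊕ Fin p)) :
    StrongConvexOn P.X θ fun x => P.lagrangian x u := by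
  refine ⟨hP.convex_X, fun x hx y hy a b ha hb hab => ?_⟩
  have h := hP.strongConvex.2 hx hy ha hb hab
  simp only [smul_eq_mul, lagrangian_eq, P.resid_convexCombo x y hab, inner_add_left,
    real_inner_smul_left] at h ⊢
  linarith

theorem Assumptions.lsc_lagrangian (u : EuclideanSpace ℝ (Fin m ⊕ Fin p)) :
    LowerSemicontinuousOn (fun x => P.lagrangian x u) P.X := by
  simp only [lagrangian_eq]
  exact hP.lsc.add
    ((P.continuous_resid.inner continuous_const).continuousOn.lowerSemicontinuousOn)

theorem Assumptions.isLagrangianMin_xbar (u : EuclideanSpace ℝ (Fin m ⊕ Fin p)) :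
    P.IsLagrangianMin u (P.xbar u) := by
  have h : ∃ x, P.IsLagrangianMin u x := (hP.strongConvexOn_lagrangian u).exists_isMinOn
    hP.theta_pos hP.closed_X hP.nonempty_X (hP.lsc_lagrangian u)
  rw [xbar, dif_pos h]
  exact h.choose_spec

theorem Assumptions.xbar_mem (u : EuclideanSpace ℝ (Fin m ⊕ Fin p)) : P.xbar u ∈ P.X :=
  (hP.isLagrangianMin_xbar u).1

theorem Assumptions.eq_xbar {u : EuclideanSpace ℝ (Fin m ⊕ Fin p)}
    {y : EuclideanSpace ℝ (Fin n)} (hy : P.IsLagrangianMin u y) : y = P.xbar u :=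
  ((hP.strongConvexOn_lagrangian u).strictConvexOn hP.theta_pos).eq_of_isMinOn hy.2
    (hP.isLagrangianMin_xbar u).2 hy.1 (hP.xbar_mem u)

theorem Assumptions.dual_eq (u : EuclideanSpace ℝ (Fin m ⊕ Fin p)) :
    P.dual u = P.lagrangian (P.xbar u) u := by
  have h : IsLeast ((fun x => P.lagrangian x u) '' P.X) (P.lagrangian (P.xbar u) u) :=
    ⟨⟨_, hP.xbar_mem u, rfl⟩, Set.forall_mem_image.2
      (isMinOn_iff.1 (hP.isLagrangianMin_xbar u).2)⟩
  exact h.csInf_eq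

theorem Assumptions.dual_add_le_lagrangian (u : EuclideanSpace ℝ (Fin m ⊕ Fin p))
    {y : EuclideanSpace ℝ (Fin n)} (hy : y ∈ P.X) :
    P.dual u + θ / 2 * ‖y - P.xbar u‖ ^ 2 ≤ P.lagrangian y u := by
  rw [hP.dual_eq]
  exact (hP.strongConvexOn_lagrangian u).quadratic_growth (hP.xbar_mem u)
    (hP.isLagrangianMin_xbar u).2 hy

theorem Assumptions.dual_le_lagrangian (u : EuclideanSpace ℝ (Fin m ⊕ Fin p))
    {y : EuclideanSpace ℝ (Fin n)} (hy : y ∈ P.X) : P.dual u ≤ P.lagrangian y u :=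
  (le_add_of_nonneg_right (mul_nonneg (half_pos hP.theta_pos).le (sq_nonneg _))).trans
    (hP.dual_add_le_lagrangian u hy)

/-- The dual function lies below its linearization, quantitatively. -/
theorem Assumptions.dual_add_le_linearization (u w : EuclideanSpace ℝ (Fin m ⊕ Fin p)) :
    P.dual w + θ / 2 * ‖P.xbar u - P.xbar w‖ ^ 2 ≤
      P.dual u + inner ℝ (P.resid (P.xbar u)) (w - u) := by
  rw [hP.dual_eq u, ← lagrangian_eq_add]
  exact hP.dual_add_le_lagrangian w (hP.xbar_mem u)

theorem Assumptions.dual_le_linearization (u w : EuclideanSpace ℝ (Fin m ⊕ Fin p)) :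
    P.dual w ≤ P.dual u + inner ℝ (P.resid (P.xbar u)) (w - u) :=
  (le_add_of_nonneg_right (mul_nonneg (half_pos hP.theta_pos).le (sq_nonneg _))).trans
    (hP.dual_add_le_linearization u w)

/-- Descent lemma: the dual function has curvature at most `σ_max(Ã)² / θ`. -/
theorem Assumptions.linearization_le_dual (u w : EuclideanSpace ℝ (Fin m ⊕ Fin p)) :
    P.dual u + inner ℝ (P.resid (P.xbar u)) (w - u)
      - sigmaMax P.At ^ 2 / (2 * θ) * ‖w - u‖ ^ 2 ≤ P.dual w := by
  have h1 := hP.dual_add_le_lagrangian u (hP.xbar_mem w)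
  have h2 := P.lagrangian_eq_add (P.xbar w) u w
  rw [← hP.dual_eq w] at h2
  have h3 := (abs_le.1 (P.abs_inner_resid_sub_le (P.xbar w) (P.xbar u) (w - u))).1
  rw [inner_sub_left] at h3
  have hθ := hP.theta_pos
  -- Completing the square absorbs the Cauchy–Schwarz cross term into the quadratic growth; what
  -- remains is exactly the curvature term.
  have h4 : 0 ≤ θ / 2 * (‖P.xbar w - P.xbar u‖ - sigmaMax P.At / θ * ‖w - u‖) ^ 2 := by
    positivity
  have h5 : θ / 2 * (‖P.xbar w - P.xbar u‖ - sigmaMax P.At / θ * ‖w - u‖) ^ 2 =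
      θ / 2 * ‖P.xbar w - P.xbar u‖ ^ 2 - sigmaMax P.At * ‖P.xbar w - P.xbar u‖ * ‖w - u‖
        + sigmaMax P.At ^ 2 / (2 * θ) * ‖w - u‖ ^ 2 := by
    field_simp
    ring
  linarith

/-- The two linearization bounds squeeze the error to `O(‖w - u‖²)`, which is `o(‖w - u‖)`. -/
theorem Assumptions.hasGradientAt_dual (u : EuclideanSpace ℝ (Fin m ⊕ Fin p)) :
    HasGradientAt P.dual (P.resid (P.xbar u)) u := by
  rw [hasGradientAt_iff_isLittleO]
  refine Asymptotics.IsBigO.trans_isLittleO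
    (Asymptotics.IsBigO.of_bound (sigmaMax P.At ^ 2 / (2 * θ)) (.of_forall fun w => ?_))
    (Asymptotics.isLittleO_pow_sub_sub u one_lt_two)
  have h1 := hP.dual_le_linearization u w
  have h2 := hP.linearization_le_dual u w
  rw [Real.norm_of_nonneg (sq_nonneg ‖w - u‖), Real.norm_eq_abs, abs_le]
  constructor <;> linarith [h1, h2]

theorem Assumptions.differentiable_dual : Differentiable ℝ P.dual := fun u =>
  (hP.hasGradientAt_dual u).differentiableAt

theorem Assumptions.ell_eq (w v : EuclideanSpace ℝ (Fin m ⊕ Fin p)) :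
    P.ell w v = -P.dual v - inner ℝ (P.resid (P.xbar v)) (w - v) := by
  rw [ell, (hP.hasGradientAt_dual v).gradient]

end Dual

end LinProblem

namespace LinProblem

variable {n m p : ℕ} {P : LinProblem n m p} {θ : ℝ}

theorem convex_D (P : LinProblem n m p) : Convex ℝ P.D := by
  intro x hx y hy a b ha hb _ i
  exact add_nonneg (mul_nonneg ha (hx i)) (mul_nonneg hb (hy i))

theorem dStar_eq {us : EuclideanSpace ℝ (Fin m ⊕ Fin p)} (hus : us ∈ P.DStar) :
    P.dStar = P.dual us := by
  have h : IsGreatest (P.dual '' P.D) (P.dual us) :=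
    ⟨⟨us, hus.1, rfl⟩, Set.forall_mem_image.2 (isMaxOn_iff.1 hus.2)⟩
  exact h.csSup_eq

theorem inner_resid_nonpos_of_feasible {y : EuclideanSpace ℝ (Fin n)} (hy : y ∈ P.feasible)
    {w : EuclideanSpace ℝ (Fin m ⊕ Fin p)} (hw : w ∈ P.D) : inner ℝ (P.resid y) w ≤ 0 := by
  rw [inner_resid]
  have h1 : ∑ i, w (Sum.inl i) * P.g i y ≤ 0 :=
    Finset.sum_nonpos fun i _ => mul_nonpos_of_nonneg_of_nonpos (hw i) (hy.2.1 i)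
  simpa [hy.2.2] using h1

/-! ### Optimality conditions, strong duality and primal error bounds -/

section Optimality

variable (hP : P.Assumptions θ) {us : EuclideanSpace ℝ (Fin m ⊕ Fin p)} (hus : us ∈ P.DStar)

include hP hus

/-- First-order optimality for the dual problem. -/
theorem Assumptions.inner_resid_nonpos {w : EuclideanSpace ℝ (Fin m ⊕ Fin p)} (hw : w ∈ P.D) :
    inner ℝ (P.resid (P.xbar us)) (w - us) ≤ 0 := by
  set K := sigmaMax P.At ^ 2 / (2 * θ) * ‖w - us‖ ^ 2 with hK
  have key : ∀ t ∈ Set.Ioo (0 : ℝ) 1, inner ℝ (P.resid (P.xbar us)) (w - us) ≤ t * K := by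
    rintro t ⟨ht0, ht1⟩
    have h1 := hP.linearization_le_dual us (us + t • (w - us))
    -- A short move towards `w` stays in `D` and cannot increase `d`; the curvature cost is of order
    -- `t²`.
    have h2 := isMaxOn_iff.1 hus.2 _ (P.convex_D.add_smul_sub_mem hus.1 hw ⟨ht0.le, ht1.le⟩)
    rw [add_sub_cancel_left, inner_smul_right, norm_smul, Real.norm_of_nonneg ht0.le] at h1
    refine le_of_mul_le_mul_left (?_ : t * _ ≤ t * _) ht0
    rw [hK]
    linarith
  have hlim : Filter.Tendsto (fun t : ℝ => t * K) (nhdsWithin 0 (Set.Ioi 0)) (nhds (0 * K)) :=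
    (Continuous.tendsto (by fun_prop) 0).mono_left nhdsWithin_le_nhds
  rw [zero_mul] at hlim
  exact ge_of_tendsto hlim (Filter.mem_of_superset (Ioo_mem_nhdsGT one_pos) key)

theorem Assumptions.g_xbar_nonpos (i : Fin m) : P.g i (P.xbar us) ≤ 0 := by
  have h := hP.inner_resid_nonpos hus (w := us + EuclideanSpace.single (Sum.inl i) 1) (by
    intro i'
    have := hus.1 i'
    by_cases hi : i' = i <;> simp [hi] <;> subst_vars <;> linarith)
  simpa [EuclideanSpace.inner_single_right] using h

/-- Equality multipliers are unrestricted in sign, so `us` can be perturbed in both directions. -/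
theorem Assumptions.eqRes_xbar_eq_zero (j : Fin p) : P.eqRes j (P.xbar us) = 0 := by
  have h (c : ℝ) := hP.inner_resid_nonpos hus (w := us + EuclideanSpace.single (Sum.inr j) c) (by
    intro i
    simpa using hus.1 i)
  have h1 := h 1
  have h2 := h (-1)
  simp only [add_sub_cancel_left, EuclideanSpace.inner_single_right, resid_inr] at h1 h2
  simp at h1 h2
  linarith

/-- Complementary slackness. -/
theorem Assumptions.inner_resid_xbar_eq_zero : inner ℝ (P.resid (P.xbar us)) us = 0 := by
  have h1 := hP.inner_resid_nonpos hus (w := 0) fun i => le_rfl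
  have h2 := hP.inner_resid_nonpos hus (w := us + us) fun i => add_nonneg (hus.1 i) (hus.1 i)
  rw [zero_sub, inner_neg_right] at h1
  rw [add_sub_cancel_left] at h2
  linarith

theorem Assumptions.xbar_mem_feasible : P.xbar us ∈ P.feasible :=
  ⟨hP.xbar_mem us, hP.g_xbar_nonpos hus, hP.eqRes_xbar_eq_zero hus⟩

theorem Assumptions.f_xbar_eq_dual : P.f (P.xbar us) = P.dual us := by
  rw [hP.dual_eq, lagrangian_eq, hP.inner_resid_xbar_eq_zero hus, add_zero]

/-- On feasible points `𝓛(·, us) ≤ f`, so the growth of the Lagrangian passes to `f`; optimality and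
uniqueness both follow. -/
theorem Assumptions.f_xbar_add_le {y : EuclideanSpace ℝ (Fin n)} (hy : y ∈ P.feasible) :
    P.f (P.xbar us) + θ / 2 * ‖y - P.xbar us‖ ^ 2 ≤ P.f y := by
  have h1 := hP.dual_add_le_lagrangian us hy.1
  have h2 := inner_resid_nonpos_of_feasible hy hus.1
  rw [lagrangian_eq] at h1
  rw [hP.f_xbar_eq_dual hus]
  linarith

theorem Assumptions.isPrimalOptimal_xbar : P.IsPrimalOptimal (P.xbar us) :=
  ⟨hP.xbar_mem_feasible hus, isMinOn_iff.2 fun _ hy =>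
    (le_add_of_nonneg_right (mul_nonneg (half_pos hP.theta_pos).le (sq_nonneg _))).trans
      (hP.f_xbar_add_le hus hy)⟩

theorem Assumptions.eq_xbar_of_isPrimalOptimal {y : EuclideanSpace ℝ (Fin n)}
    (hy : P.IsPrimalOptimal y) : y = P.xbar us := by
  have h1 := hP.f_xbar_add_le hus hy.1
  have h2 := isMinOn_iff.1 hy.2 _ (hP.xbar_mem_feasible hus)
  have h3 : ‖y - P.xbar us‖ ^ 2 ≤ 0 := by
    have := half_pos hP.theta_pos
    exact nonpos_of_mul_nonpos_right (by linarith) this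
  rw [← sub_eq_zero, ← norm_eq_zero]
  exact pow_eq_zero_iff two_ne_zero |>.1 (le_antisymm h3 (sq_nonneg _))

/-- Strong duality. -/
theorem Assumptions.fStar_eq : P.fStar = P.dual us := by
  have h : IsLeast (P.f '' P.feasible) (P.f (P.xbar us)) :=
    ⟨⟨_, hP.xbar_mem_feasible hus, rfl⟩, Set.forall_mem_image.2
      (isMinOn_iff.1 (hP.isPrimalOptimal_xbar hus).2)⟩
  rw [fStar, h.csInf_eq, hP.f_xbar_eq_dual hus]

/-- The bridge from dual gap to primal distance: in the strengthened linearization bound at `us`,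
the linear term is nonpositive on `D`. -/
theorem Assumptions.norm_xbar_sub_sq_le {w : EuclideanSpace ℝ (Fin m ⊕ Fin p)} (hw : w ∈ P.D) :
    θ / 2 * ‖P.xbar w - P.xbar us‖ ^ 2 ≤ P.dStar - P.dual w := by
  have h1 := hP.dual_add_le_linearization us w
  have h2 := hP.inner_resid_nonpos hus hw
  rw [dStar_eq hus, norm_sub_rev]
  linarith

/-- Because `x̄(us)` is feasible, each violation at `x` is at most the change of that residual
between the two points. -/
theorem Assumptions.infeas_le (x : EuclideanSpace ℝ (Fin n)) :
    P.infeas x ≤ sigmaMax P.At * ‖x - P.xbar us‖ := by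
  refine le_trans (Real.sqrt_le_iff.2 ⟨norm_nonneg _, ?_⟩) (P.norm_resid_sub_le x (P.xbar us))
  rw [EuclideanSpace.real_norm_sq_eq, Fintype.sum_sum_type, add_comm]
  refine add_le_add (Finset.sum_le_sum fun i _ => ?_) (Finset.sum_le_sum fun j _ => ?_)
  · have h := hP.g_xbar_nonpos hus i
    rw [PiLp.sub_apply, resid_inl, resid_inl]
    rcases le_total (P.g i x) 0 with h0 | h0
    · rw [max_eq_left h0, zero_pow two_ne_zero]
      exact sq_nonneg _
    · rw [max_eq_right h0]
      exact pow_le_pow_left₀ h0 (by linarith) 2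
  · simp [hP.eqRes_xbar_eq_zero hus j]

/-- Lower bound on the primal objective through the infeasibility. -/
theorem Assumptions.neg_norm_mul_infeas_le {x : EuclideanSpace ℝ (Fin n)} (hx : x ∈ P.X) :
    -(‖us‖ * P.infeas x) ≤ P.f x - P.fStar := by
  have h1 := hP.dual_le_lagrangian us hx
  rw [lagrangian_eq] at h1
  set r : EuclideanSpace ℝ (Fin m ⊕ Fin p) :=
    WithLp.toLp 2 (Sum.elim (fun i => max 0 (P.g i x)) fun j => P.eqRes j x) with hr
  have h2 : inner ℝ (P.resid x) us ≤ inner ℝ r us := by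
    simp only [PiLp.inner_apply, Fintype.sum_sum_type]
    refine add_le_add (Finset.sum_le_sum fun i _ => ?_) le_rfl
    simpa [hr] using mul_le_mul_of_nonneg_left (le_max_right 0 (P.g i x)) (hus.1 i)
  have h3 : ‖r‖ = P.infeas x := by
    rw [infeas, EuclideanSpace.norm_eq, Fintype.sum_sum_type, add_comm]
    simp [hr]
  have h4 := real_inner_le_norm r us
  rw [hP.fStar_eq hus, ← h3]
  linarith [mul_comm ‖r‖ ‖us‖]

/-- Testing the minimality of `x̄(w)` for `𝓛(·, w)` against `x̄(us)` bounds the objective gap by a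
residual difference paired with `w`. -/
theorem Assumptions.f_xbar_sub_fStar_le {w : EuclideanSpace ℝ (Fin m ⊕ Fin p)} :
    P.f (P.xbar w) - P.fStar ≤ ‖w‖ * (sigmaMax P.At * ‖P.xbar w - P.xbar us‖) := by
  have h1 := hP.dual_le_lagrangian w (hP.xbar_mem us)
  rw [hP.dual_eq w, lagrangian_eq, lagrangian_eq, hP.f_xbar_eq_dual hus, ← hP.fStar_eq hus] at h1
  have h2 := (abs_le.1 (P.abs_inner_resid_sub_le (P.xbar w) (P.xbar us) w)).1
  rw [inner_sub_left] at h2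
  linarith [mul_comm ‖w‖ (sigmaMax P.At * ‖P.xbar w - P.xbar us‖)]

end Optimality

/-! ### Convergence rate of the accelerated method -/

section Tseng

variable (hP : P.Assumptions θ) {β : ℕ → ℝ} {U : ℕ → Set (EuclideanSpace ℝ (Fin m ⊕ Fin p))}
  {v u : ℕ → EuclideanSpace ℝ (Fin m ⊕ Fin p)} (hrun : P.IsTsengRun θ β U v u)
  {us : EuclideanSpace ℝ (Fin m ⊕ Fin p)} (hus : us ∈ P.DStar)
  (hU : ∀ k, (1 - β k) • u k + β k • us ∈ U k)

include hrun

theorem IsTsengRun.beta_le_two_div (k : ℕ) : β k ≤ 2 / ((k : ℝ) + 2) := by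
  rcases k with _ | k
  · simp [hrun.beta_zero]
  · refine (hrun.beta_le k).trans_eq ?_
    push_cast
    ring

theorem IsTsengRun.beta_le_one (k : ℕ) : β k ≤ 1 :=
  (hrun.beta_le_two_div k).trans <| (div_le_one (by positivity)).2 (by linarith [k.cast_nonneg (α := ℝ)])

theorem IsTsengRun.mem_D (k : ℕ) : u k ∈ P.D := by
  rcases k with _ | k
  · exact hrun.u_zero
  · exact (hrun.u_succ_mem k).2

include hP hus hU

/-- One step of the method, in terms of the gap `d⋆ - d(u_k)`. -/
theorem Assumptions.tseng_step (k : ℕ) :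
    P.dStar - P.dual (u (k + 1)) ≤ (1 - β k) * (P.dStar - P.dual (u k))
      + sigmaMax P.At ^ 2 / (2 * θ) * (‖(1 - β k) • u k + β k • us - v k‖ ^ 2
        - ‖(1 - β k) • u k + β k • us - u (k + 1)‖ ^ 2) := by
  set y := (1 - β k) • u k + β k • us with hy
  have hb0 := (hrun.beta_pos k).le
  have hb1 := sub_nonneg.2 (hrun.beta_le_one k)
  have hyD : y ∈ P.D := P.convex_D (hrun.mem_D k) hus.1 hb1 hb0 (by ring)
  have hc : sigmaMax P.At ^ 2 / (2 * θ) = sigmaMax P.At ^ 2 / θ / 2 := by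
    have := hP.theta_pos.ne'
    field_simp
  have hmin := hrun.u_succ_min k
  simp only [hP.ell_eq, hc] at hmin
  -- The competitor is `y`, admissible by `hU` and convexity of `D`. The descent lemma at `u (k +
  -- 1)` and concavity at `u k` and `us`, weighted by `1 - β k` and `β k`, turn linearizations into
  -- values of `d`.
  have h1 := prox_three_point ((hrun.U_convex k).inter P.convex_D) (-P.dual (v k)) _
    (P.resid (P.xbar (v k))) (v k) (hrun.u_succ_mem k) hmin (y := y) ⟨hU k, hyD⟩
  have h2 := hP.linearization_le_dual (v k) (u (k + 1))
  have h3 := mul_le_mul_of_nonneg_left (hP.dual_le_linearization (v k) (u k)) hb1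
  have h4 := mul_le_mul_of_nonneg_left (hP.dual_le_linearization (v k) us) hb0
  have h5 : y - v k = (1 - β k) • (u k - v k) + β k • (us - v k) := by
    rw [hy]
    module
  have h6 : inner ℝ (P.resid (P.xbar (v k))) (y - v k) =
      (1 - β k) * inner ℝ (P.resid (P.xbar (v k))) (u k - v k)
        + β k * inner ℝ (P.resid (P.xbar (v k))) (us - v k) := by
    rw [h5, inner_add_right, inner_smul_right, inner_smul_right]
  rw [h6] at h1
  rw [hc] at h2 ⊢
  rw [dStar_eq hus]
  linarith

/-- The Lyapunov inequality for Tseng's method. -/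
theorem Assumptions.tseng_lyapunov (k : ℕ) :
    P.dStar - P.dual (u (k + 1)) + sigmaMax P.At ^ 2 / (2 * θ) *
        ‖(1 - β k) • u k + β k • us - u (k + 1)‖ ^ 2
      ≤ β k ^ 2 * (sigmaMax P.At ^ 2 / (2 * θ) * ‖u 0 - us‖ ^ 2) := by
  induction k with
  | zero =>
    have h := hP.tseng_step hrun hus hU 0
    simp only [hrun.beta_zero, hrun.v_zero, sub_self, zero_smul, one_smul, zero_add, zero_mul,
      one_pow, one_mul] at h ⊢
    rw [norm_sub_rev (u 0)]
    linarith
  | succ k ih =>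
    have h := hP.tseng_step hrun hus hU (k + 1)
    have hb := hrun.beta_pos k
    have hb' := hrun.beta_pos (k + 1)
    -- The momentum coefficient is tuned for this identity: the new distance term is the old one
    -- rescaled, so after division by `β²` the distance terms telescope.
    have e : (1 - β (k + 1)) • u (k + 1) + β (k + 1) • us - v (k + 1) =
        (β (k + 1) / β k) • ((1 - β k) • u k + β k • us - u (k + 1)) := by
      rw [hrun.v_succ]
      match_scalars
      · field_simp
        ring
      · field_simp
      · field_simp
    rw [e, norm_smul, Real.norm_of_nonneg (by positivity), mul_pow, div_pow] at h
    set q := β (k + 1) ^ 2 / β k ^ 2 with hq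
    have hgap : 0 ≤ P.dStar - P.dual (u (k + 1)) := by
      rw [dStar_eq hus]
      exact sub_nonneg.2 (hus.2 (hrun.mem_D _))
    have hs : 1 - β (k + 1) ≤ q := by
      have := hrun.beta_step k
      rw [div_le_iff₀ (by positivity)] at this
      rw [hq]
      exact this.trans_eq (by ring)
    have h1 := mul_le_mul_of_nonneg_right hs hgap
    have h2 := mul_le_mul_of_nonneg_left ih (by positivity : 0 ≤ q)
    have h3 : q * (β k ^ 2 * (sigmaMax P.At ^ 2 / (2 * θ) * ‖u 0 - us‖ ^ 2)) =
        β (k + 1) ^ 2 * (sigmaMax P.At ^ 2 / (2 * θ) * ‖u 0 - us‖ ^ 2) := by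
      rw [hq]
      field_simp
    linarith

theorem Assumptions.dStar_sub_dual_le {k : ℕ} (hk : 1 ≤ k) :
    P.dStar - P.dual (u k) ≤
      2 * sigmaMax P.At ^ 2 * ‖u 0 - us‖ ^ 2 / (θ * ((k : ℝ) + 1) ^ 2) := by
  -- The iterate `u (k + 1)` is governed by `β k ≤ 2 / (k + 2)`, whence the denominator `index + 1`.
  obtain ⟨k, rfl⟩ := Nat.exists_eq_add_of_le' hk
  have hθ := hP.theta_pos
  have h1 := hP.tseng_lyapunov hrun hus hU k
  have h2 : 0 ≤ sigmaMax P.At ^ 2 / (2 * θ) *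
      ‖(1 - β k) • u k + β k • us - u (k + 1)‖ ^ 2 := by positivity
  have h3 := pow_le_pow_left₀ (hrun.beta_pos k).le (hrun.beta_le_two_div k) 2
  have h4 := mul_le_mul_of_nonneg_right h3
    (by positivity : 0 ≤ sigmaMax P.At ^ 2 / (2 * θ) * ‖u 0 - us‖ ^ 2)
  have h5 : (2 / ((k : ℝ) + 2)) ^ 2 * (sigmaMax P.At ^ 2 / (2 * θ) * ‖u 0 - us‖ ^ 2) =
      2 * sigmaMax P.At ^ 2 * ‖u 0 - us‖ ^ 2 / (θ * (((k + 1 : ℕ) : ℝ) + 1) ^ 2) := by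
    have : ((k + 1 : ℕ) : ℝ) + 1 = k + 2 := by push_cast; ring
    rw [this]
    field_simp
  linarith

theorem Assumptions.norm_xbar_sub_le {k : ℕ} (hk : 1 ≤ k) :
    ‖P.xbar (u k) - P.xbar us‖ ≤ 2 * sigmaMax P.At * ‖u 0 - us‖ / (θ * ((k : ℝ) + 1)) := by
  have hθ := hP.theta_pos
  have hσ := sigmaMax_nonneg P.At
  refine le_of_sq_le_sq ?_ (by positivity)
  have h := (hP.norm_xbar_sub_sq_le hus (hrun.mem_D k)).trans
    (hP.dStar_sub_dual_le hrun hus hU hk)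
  refine le_of_mul_le_mul_left (h.trans_eq ?_) (half_pos hθ)
  field_simp

end Tseng

/-- Bound on the multipliers of an inequality constrained problem through a Slater point. -/
theorem Assumptions.norm_le_of_isSlater (hP : P.Assumptions θ) (hp : p = 0)
    {xt : EuclideanSpace ℝ (Fin n)} (hxt : P.IsSlater xt)
    {w : EuclideanSpace ℝ (Fin m ⊕ Fin p)} (hw : w ∈ P.D) {c : ℝ} (hc : c ≤ P.dual w) :
    (⨆ i, P.g i xt) < 0 ∧ ‖w‖ ≤ (c - P.f xt) / ⨆ i, P.g i xt := by
  subst hp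
  have : Nonempty (Fin m) := ⟨⟨0, Nat.pos_of_ne_zero (by simpa using hP.constraints)⟩⟩
  obtain ⟨i₀, hi₀⟩ := exists_eq_ciSup_of_finite (f := fun i => P.g i xt)
  have hM : (⨆ i, P.g i xt) < 0 := hi₀ ▸ hxt.2.1 i₀
  refine ⟨hM, ?_⟩
  have h1 := hc.trans (hP.dual_le_lagrangian w (intrinsicInterior_subset hxt.1))
  rw [lagrangian_eq, inner_resid, Finset.univ_eq_empty (α := Fin 0), Finset.sum_empty,
    add_zero] at h1
  -- This bounds the `ℓ¹` norm of `w`, which dominates the Euclidean one; dividing by the negative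
  -- maximum flips the inequality.
  have h2 : ∑ i, w (Sum.inl i) * P.g i xt ≤ (∑ i, w (Sum.inl i)) * ⨆ i, P.g i xt := by
    rw [Finset.sum_mul]
    exact Finset.sum_le_sum fun i _ => mul_le_mul_of_nonneg_left
      (le_ciSup (f := fun i => P.g i xt) (Set.finite_range _).bddAbove i) (hw i)
  have h3 : ‖w‖ ≤ ∑ i, w (Sum.inl i) := by
    have hnn : 0 ≤ ∑ i, w (Sum.inl i) := Finset.sum_nonneg fun i _ => hw i
    refine le_of_sq_le_sq ?_ hnn
    rw [EuclideanSpace.real_norm_sq_eq, Fintype.sum_sum_type, Finset.univ_eq_empty (α := Fin 0),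
      Finset.sum_empty, add_zero]
    exact Finset.sum_sq_le_sq_sum_of_nonneg fun i _ => hw i
  refine h3.trans ((le_div_iff_of_neg hM).2 ?_)
  linarith

end LinProblem

theorem mainTheorem8 {n m p : ℕ} (P : LinProblem n m p) (θ : ℝ) (hP : P.Assumptions θ)
    (β : ℕ → ℝ) (U : ℕ → Set (EuclideanSpace ℝ (Fin m ⊕ Fin p)))
    (v u : ℕ → EuclideanSpace ℝ (Fin m ⊕ Fin p)) (hrun : P.IsTsengRun θ β U v u)
    (ustar : EuclideanSpace ℝ (Fin m ⊕ Fin p)) (hustar : ustar ∈ P.DStar)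
    (hU : ∀ k, (1 - β k) • u k + β k • ustar ∈ U k) :
    (∀ w, P.IsLagrangianMin w (P.xbar w) ∧ ∀ y, P.IsLagrangianMin w y → y = P.xbar w) ∧
    Differentiable ℝ P.dual ∧
    ∃ xstar, P.IsPrimalOptimal xstar ∧ (∀ y, P.IsPrimalOptimal y → y = xstar) ∧
      (∀ k : ℕ, 1 ≤ k →
        P.dStar - P.dual (u k)
          ≤ 2 * sigmaMax P.At ^ 2 * ‖u 0 - ustar‖ ^ 2 / (θ * ((k : ℝ) + 1) ^ 2) ∧
        ‖P.xbar (u k) - xstar‖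
          ≤ 2 * sigmaMax P.At * ‖u 0 - ustar‖ / (θ * ((k : ℝ) + 1)) ∧
        -(2 * ‖ustar‖ * sigmaMax P.At ^ 2 * ‖u 0 - ustar‖ / (θ * ((k : ℝ) + 1)))
          ≤ P.f (P.xbar (u k)) - P.fStar ∧
        P.f (P.xbar (u k)) - P.fStar
          ≤ 2 * ‖u k‖ * sigmaMax P.At ^ 2 * ‖u 0 - ustar‖ / (θ * ((k : ℝ) + 1)) ∧
        P.infeas (P.xbar (u k))
          ≤ 2 * sigmaMax P.At ^ 2 * ‖u 0 - ustar‖ / (θ * ((k : ℝ) + 1))) ∧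
      (p = 0 → ∀ xtilde, P.IsSlater xtilde → ∀ ubar ∈ P.D \ P.DStar, ∀ k : ℕ,
        sigmaMax P.At * ‖u 0 - ustar‖ * Real.sqrt (2 * θ⁻¹ / (P.dStar - P.dual ubar)) < (k : ℝ) →
        P.f (P.xbar (u k)) - P.fStar
          ≤ 2 * sigmaMax P.At ^ 2 * (P.dual ubar - P.f xtilde) * ‖u 0 - ustar‖
              / (θ * ((k : ℝ) + 1) * ⨆ i, P.g i xtilde)) := by

  have hθ := hP.theta_pos
  have hσ := sigmaMax_nonneg P.At
  have hdist (k : ℕ) (hk : 1 ≤ k) := hP.norm_xbar_sub_le hrun hustar hU hk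
  have hres (k : ℕ) (hk : 1 ≤ k) : sigmaMax P.At * ‖P.xbar (u k) - P.xbar ustar‖ ≤
      2 * sigmaMax P.At ^ 2 * ‖u 0 - ustar‖ / (θ * ((k : ℝ) + 1)) :=
    (mul_le_mul_of_nonneg_left (hdist k hk) hσ).trans_eq (by ring)
  have hinf (k : ℕ) (hk : 1 ≤ k) := (hP.infeas_le hustar (P.xbar (u k))).trans (hres k hk)
  have hupper (k : ℕ) (hk : 1 ≤ k) := (hP.f_xbar_sub_fStar_le hustar (w := u k)).trans
    (mul_le_mul_of_nonneg_left (hres k hk) (norm_nonneg _))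
  refine ⟨fun w => ⟨hP.isLagrangianMin_xbar w, fun y hy => hP.eq_xbar hy⟩,
    hP.differentiable_dual, P.xbar ustar, hP.isPrimalOptimal_xbar hustar,
    fun y hy => hP.eq_xbar_of_isPrimalOptimal hustar hy, fun k hk =>
    ⟨hP.dStar_sub_dual_le hrun hustar hU hk, hdist k hk, ?_, ?_, hinf k hk⟩, ?_⟩
  · refine le_trans (neg_le_neg ?_)
      (hP.neg_norm_mul_infeas_le hustar (hP.xbar_mem (u k)))
    exact (mul_le_mul_of_nonneg_left (hinf k hk) (norm_nonneg _)).trans_eq (by ring)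
  · exact (hupper k hk).trans_eq (by ring)
  · rintro hp xtilde hxt ubar ⟨hubD, hub⟩ k hk
    have hgap : 0 < P.dStar - P.dual ubar := by
      rw [LinProblem.dStar_eq hustar, sub_pos]
      by_contra! hle
      exact hub ⟨hubD, isMaxOn_iff.2 fun w hw => (isMaxOn_iff.1 hustar.2 w hw).trans hle⟩
    have hk0 : (0 : ℝ) < k := lt_of_le_of_lt (by positivity) hk
    have hk1 : 1 ≤ k := Nat.cast_pos.1 hk0
    -- The threshold on `k` is the point where the dual rate guarantees this, so the Slater bound
    -- applies with `c = P.dual ubar`.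
    have hdual : P.dual ubar ≤ P.dual (u k) := by
      have h1 := hP.dStar_sub_dual_le hrun hustar hU hk1
      have h2 := pow_le_pow_left₀ (by positivity) hk.le 2
      rw [mul_pow, mul_pow, Real.sq_sqrt (by positivity), ← mul_div_assoc,
        div_le_iff₀ hgap] at h2
      have h3 : 2 * sigmaMax P.At ^ 2 * ‖u 0 - ustar‖ ^ 2 / (θ * ((k : ℝ) + 1) ^ 2) ≤
          P.dStar - P.dual ubar := by
        rw [← div_div, div_le_iff₀ (by positivity)]
        calc 2 * sigmaMax P.At ^ 2 * ‖u 0 - ustar‖ ^ 2 / θ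
            = sigmaMax P.At ^ 2 * ‖u 0 - ustar‖ ^ 2 * (2 * θ⁻¹) := by ring
          _ ≤ (k : ℝ) ^ 2 * (P.dStar - P.dual ubar) := h2
          _ ≤ ((k : ℝ) + 1) ^ 2 * (P.dStar - P.dual ubar) := by gcongr; linarith
          _ = _ := mul_comm _ _
      linarith
    obtain ⟨hM, hnorm⟩ := hP.norm_le_of_isSlater hp hxt (hrun.mem_D k) hdual
    refine (hupper k hk1).trans ((mul_le_mul_of_nonneg_right hnorm (by positivity)).trans_eq ?_)
    have := hM.ne
    field_simp
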